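/- Let $Y$ be a metric space with metric $d$, let $X$ be a topological space and let $f\colon X\to Y$ be a function. Diameters take values in $[0,\infty]$, and the diameter of the empty set is $0$. Consider the following properties of $f$. (WS) For every $\varepsilon>0$ there are open sets $V_x\ni x$ $(x\in X)$ such that, for all $x,y\in X$, $(x,y)\in V_y\times V_x$ implies $d(f(x),f(y))<\varepsilon$. (Frag) For every $\varepsilon>0$ and every nonempty closed $F\subseteq X$ there is an open $U\subseteq X$ with $U\cap F\ne\emptyset$ and $\operatorname{diam} f(U\cap F)<\varepsilon$. (Cliq) For every $\varepsilon>0$ and every nonempty open $U\subseteq X$ there is a nonempty open $O\subseteq U$ with $\operatorname{diam} f(O)<\varepsilon$. (LP) For every $\varepsilon>0$ there is a cover $(X_n)_{n\in\mathbb N}$ of $X$ by closed sets with $\operatorname{diam} f(X_n)\le\varepsilon$ for all $n$. (GLP) For every $\varepsilon>0$ there is a $\sigma$-discrete family $\mathcal A$ of closed subsets of $X$ with $X=\bigcup\mathcal A$ and $\operatorname{diam} f(A)\le\varepsilon$ for all $A\in\mathcal A$. (A family of subsets of $X$ is discrete if every point of $X$ has a neighbourhood meeting at most one member of the family, and $\sigma$-discrete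 if it is a countable union of discrete families.) (PCP) For every nonempty closed $F\subseteq X$ the restriction $f\restriction_F$ has a point of continuity. (PWD) For every nonempty open $U\subseteq X$ the restriction $f\restriction_U$ has a point of continuity. (Borel 1) For every open $V\subseteq Y$ the set $f^{-1}(V)$ is $F_\sigma$ in $X$. (LTZ) (for $X$ metric with metric $\varrho$) For every $\varepsilon>0$ there is a function $\delta\colon X\to(0,\infty)$ such that, for all $x,y\in X$, $\varrho(x,y)<\min\{\delta(x),\delta(y)\}$ implies $d(f(x),f(y))<\varepsilon$. A topological space is hereditarily Baire if each of its closed subspaces is a Baire space. **Theorem.** (A) Let $X$ be any topological space, $Y$ any metric space and $f\colon X\to Y$ any function. Then: Frag $\Rightarrow$ Cliq; Frag $\Rightarrow$ WS; GLP $\Rightarrow$ WS; LP $\Rightarrow$ GLP; PCP $\Rightarrow$ Frag; GLP $\Rightarrow$ Borel 1; PWD $\Rightarrow$ Cliq. If $X$ is a Baire space, then GLP $\Rightarrow$ Cliq and Cliq $\Rightarrow$ PWD. If $X$ is hereditarily Baire, then Frag $\Rightarrow$ PCP and GLP $\Rightarrow$ Frag. If $Y$ is separable, then Borel 1 $\Rightarrow$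 LP. (B) Let $X$ and $Y$ be any metric spaces and $f\colon X\to Y$ any function. Then: WS $\Leftrightarrow$ LTZ; GLP $\Leftrightarrow$ LTZ; WS $\Rightarrow$ GLP; Frag $\Rightarrow$ Borel 1. If $X$ is separable, then GLP $\Rightarrow$ LP. If $X$ is hereditarily Baire, then Borel 1 $\Rightarrow$ PCP, WS $\Rightarrow$ Frag and Borel 1 $\Rightarrow$ WS. -/

import Mathlib

open Set Topology

/-- A set is `F_σ` if it is the union of a sequence of closed sets. -/
def IsFSigmaSet {X : Type*} [TopologicalSpace X] (S : Set X) : Prop :=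
  ∃ C : ℕ → Set X, (∀ n, IsClosed (C n)) ∧ S = ⋃ n, C n

/-- A family of subsets is discrete if every point has a neighbourhood which meets at most one
member of the family. -/
def IsDiscreteFamily {X : Type*} [TopologicalSpace X] (A : Set (Set X)) : Prop :=
  ∀ x : X, ∃ U ∈ 𝓝 x, ∀ S ∈ A, ∀ T ∈ A, (S ∩ U).Nonempty → (T ∩ U).Nonempty → S = T

/-- A family of subsets is σ-discrete if it is a countable union of discrete families. -/
def IsSigmaDiscreteFamily {X : Type*} [TopologicalSpace X] (A : Set (Set X)) : Prop :=
  ∃ B : ℕ → Set (Set X), (∀ n, IsDiscreteFamily (B n)) ∧ A = ⋃ n, B n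

/-- Every closed subspace is a Baire space. -/
def IsHereditarilyBaire (X : Type*) [TopologicalSpace X] : Prop :=
  ∀ F : Set X, IsClosed F → BaireSpace F

/-- (WS); `V` is the neighbourhood assignment. -/
def WeaklySeparated {X Y : Type*} [TopologicalSpace X] [MetricSpace Y] (f : X → Y) : Prop :=
  ∀ ε : ℝ, 0 < ε → ∃ V : X → Set X, (∀ x, IsOpen (V x) ∧ x ∈ V x) ∧
    ∀ x y, x ∈ V y → y ∈ V x → dist (f x) (f y) < ε

/-- (Frag). The diameter is taken with values in `[0, ∞]`. -/
def Fragmentable {X Y : Type*} [TopologicalSpace X] [MetricSpace Y] (f : X → Y) : Prop :=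
  ∀ ε : ℝ, 0 < ε → ∀ F : Set X, IsClosed F → F.Nonempty →
    ∃ U : Set X, IsOpen U ∧ (U ∩ F).Nonempty ∧ Metric.ediam (f '' (U ∩ F)) < ENNReal.ofReal ε

/-- (Cliq) -/
def Cliquish {X Y : Type*} [TopologicalSpace X] [MetricSpace Y] (f : X → Y) : Prop :=
  ∀ ε : ℝ, 0 < ε → ∀ U : Set X, IsOpen U → U.Nonempty →
    ∃ O : Set X, IsOpen O ∧ O.Nonempty ∧ O ⊆ U ∧ Metric.ediam (f '' O) < ENNReal.ofReal ε

/-- (LP), the Lebesgue property. -/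
def LebesgueProperty {X Y : Type*} [TopologicalSpace X] [MetricSpace Y] (f : X → Y) : Prop :=
  ∀ ε : ℝ, 0 < ε → ∃ C : ℕ → Set X, (∀ n, IsClosed (C n)) ∧ (⋃ n, C n) = univ ∧
    ∀ n, Metric.ediam (f '' C n) ≤ ENNReal.ofReal ε

/-- (GLP), the generalized Lebesgue property. -/
def GeneralizedLebesgueProperty {X Y : Type*} [TopologicalSpace X] [MetricSpace Y]
    (f : X → Y) : Prop :=
  ∀ ε : ℝ, 0 < ε → ∃ A : Set (Set X), IsSigmaDiscreteFamily A ∧ (∀ S ∈ A, IsClosed S) ∧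
    ⋃₀ A = univ ∧ ∀ S ∈ A, Metric.ediam (f '' S) ≤ ENNReal.ofReal ε

/-- (PCP), the point of continuity property. -/
def PointOfContinuityProperty {X Y : Type*} [TopologicalSpace X] [MetricSpace Y]
    (f : X → Y) : Prop :=
  ∀ F : Set X, IsClosed F → F.Nonempty → ∃ x : F, ContinuousAt (F.domRestrict f) x

/-- (PWD) -/
def PointwiseDiscontinuous {X Y : Type*} [TopologicalSpace X] [MetricSpace Y]
    (f : X → Y) : Prop :=
  ∀ U : Set X, IsOpen U → U.Nonempty → ∃ x : U, ContinuousAt (U.domRestrict f) x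

/-- (Borel 1) -/
def BorelOne {X Y : Type*} [TopologicalSpace X] [MetricSpace Y] (f : X → Y) : Prop :=
  ∀ V : Set Y, IsOpen V → IsFSigmaSet (f ⁻¹' V)

/-- (LTZ), the Lee-Tang-Zhao property. -/
def LTZProperty {X Y : Type*} [MetricSpace X] [MetricSpace Y] (f : X → Y) : Prop :=
  ∀ ε : ℝ, 0 < ε → ∃ δ : X → ℝ, (∀ x, 0 < δ x) ∧
    ∀ x y, dist x y < min (δ x) (δ y) → dist (f x) (f y) < ε

-- All the separation arguments rank points. A fragmentable `f` lets `X` be exhausted transfinitely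
-- by open sets with small oscillation on what is left; a σ-discrete closed cover ranks points by
-- the first family covering them. If each neighbourhood misses the points of smaller rank, mutual
-- membership forces equal rank, which gives (WS). For metric `X`, the closures of `{δ ≥ 1/(n+1)}`,
-- cut by σ-discrete closed covers of mesh below `1/(n+1)`, turn (LTZ) into (GLP). On Baire spaces
-- the union of one discrete family has interior, whence cliquishness and residually many continuity
-- points. The delicate arrow is Borel 1 ⇒ Frag for nonseparable `Y`: a failure is witnessed on a
-- countable set `D`, so on `closure D` countably many real functions of `f` suffice.

universe u v

/-! ### Diameters as pairwise distance bounds -/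

section Diameter

variable {X : Type u} {Y : Type v} [MetricSpace Y] {f : X → Y} {s : Set X} {ε : ℝ}

theorem ediam_image_le_ofReal_iff (hε : 0 ≤ ε) :
    Metric.ediam (f '' s) ≤ ENNReal.ofReal ε ↔ ∀ x ∈ s, ∀ y ∈ s, dist (f x) (f y) ≤ ε := by
  simp only [Metric.ediam_image_le_iff, edist_le_ofReal hε]

theorem dist_le_of_ediam_image_lt (hε : 0 ≤ ε) (h : Metric.ediam (f '' s) < ENNReal.ofReal ε) :
    ∀ x ∈ s, ∀ y ∈ s, dist (f x) (f y) ≤ ε :=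
  (ediam_image_le_ofReal_iff hε).1 h.le

theorem ediam_image_lt_of_dist_le_half (hε : 0 < ε)
    (h : ∀ x ∈ s, ∀ y ∈ s, dist (f x) (f y) ≤ ε / 2) :
    Metric.ediam (f '' s) < ENNReal.ofReal ε :=
  ((ediam_image_le_ofReal_iff (half_pos hε).le).2 h).trans_lt
    ((ENNReal.ofReal_lt_ofReal_iff hε).2 (half_lt_self hε))

end Diameter

/-! ### Forms of the properties without diameters -/

section Characterizations

variable {X : Type u} {Y : Type v} [TopologicalSpace X] [MetricSpace Y] {f : X → Y}

/-- Passing to `ε / 2` absorbs the gap between strict and nonstrict bounds. -/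
theorem fragmentable_iff :
    Fragmentable f ↔ ∀ ε : ℝ, 0 < ε → ∀ F : Set X, IsClosed F → F.Nonempty →
      ∃ U : Set X, IsOpen U ∧ (U ∩ F).Nonempty ∧
        ∀ x ∈ U ∩ F, ∀ y ∈ U ∩ F, dist (f x) (f y) ≤ ε := by
  constructor
  · intro h ε hε F hF hne
    obtain ⟨U, hU, hUF, hd⟩ := h ε hε F hF hne
    exact ⟨U, hU, hUF, dist_le_of_ediam_image_lt hε.le hd⟩
  · intro h ε hε F hF hne
    obtain ⟨U, hU, hUF, hd⟩ := h (ε / 2) (half_pos hε) F hF hne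
    exact ⟨U, hU, hUF, ediam_image_lt_of_dist_le_half hε hd⟩

theorem cliquish_iff :
    Cliquish f ↔ ∀ ε : ℝ, 0 < ε → ∀ U : Set X, IsOpen U → U.Nonempty →
      ∃ O : Set X, IsOpen O ∧ O.Nonempty ∧ O ⊆ U ∧
        ∀ x ∈ O, ∀ y ∈ O, dist (f x) (f y) ≤ ε := by
  constructor
  · intro h ε hε U hU hne
    obtain ⟨O, hO, hOne, hOU, hd⟩ := h ε hε U hU hne
    exact ⟨O, hO, hOne, hOU, dist_le_of_ediam_image_lt hε.le hd⟩
  · intro h ε hε U hU hne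
    obtain ⟨O, hO, hOne, hOU, hd⟩ := h (ε / 2) (half_pos hε) U hU hne
    exact ⟨O, hO, hOne, hOU, ediam_image_lt_of_dist_le_half hε hd⟩

theorem lebesgueProperty_iff :
    LebesgueProperty f ↔ ∀ ε : ℝ, 0 < ε → ∃ 𝒞 : Set (Set X), 𝒞.Countable ∧
      (∀ S ∈ 𝒞, IsClosed S) ∧ (∀ x, ∃ S ∈ 𝒞, x ∈ S) ∧
      ∀ S ∈ 𝒞, ∀ x ∈ S, ∀ y ∈ S, dist (f x) (f y) ≤ ε := by
  constructor
  · intro h ε hε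
    obtain ⟨C, hC, hcov, hd⟩ := h ε hε
    refine ⟨range C, countable_range C, forall_mem_range.2 hC, fun x => ?_,
      forall_mem_range.2 fun n => (ediam_image_le_ofReal_iff hε.le).1 (hd n)⟩
    obtain ⟨n, hn⟩ := mem_iUnion.1 (hcov ▸ mem_univ x)
    exact ⟨C n, mem_range_self n, hn⟩
  · intro h ε hε
    obtain ⟨𝒞, hcount, hcl, hcov, hd⟩ := h ε hε
    -- Adding `∅` makes the family nonempty, hence enumerable by `ℕ` even when `X` is empty.
    obtain ⟨C, hC⟩ := (hcount.insert ∅).exists_eq_range (insert_nonempty _ _)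
    have hmem : ∀ n, C n = ∅ ∨ C n ∈ 𝒞 := fun n => by
      have : C n ∈ insert ∅ 𝒞 := hC ▸ mem_range_self n
      exact this
    refine ⟨C, fun n => ?_, eq_univ_of_forall fun x => ?_, fun n => ?_⟩
    · rcases hmem n with h | h
      · rw [h]; exact isClosed_empty
      · exact hcl _ h
    · obtain ⟨S, hS, hx⟩ := hcov x
      obtain ⟨n, rfl⟩ : S ∈ range C := hC ▸ mem_insert_of_mem _ hS
      exact mem_iUnion.2 ⟨n, hx⟩
    · rw [ediam_image_le_ofReal_iff hε.le]
      rcases hmem n with h | h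
      · simp [h]
      · exact hd _ h

theorem generalizedLebesgueProperty_iff :
    GeneralizedLebesgueProperty f ↔ ∀ ε : ℝ, 0 < ε → ∃ B : ℕ → Set (Set X),
      (∀ n, IsDiscreteFamily (B n)) ∧ (∀ n, ∀ S ∈ B n, IsClosed S) ∧
      (∀ x, ∃ n, ∃ S ∈ B n, x ∈ S) ∧
      ∀ n, ∀ S ∈ B n, ∀ x ∈ S, ∀ y ∈ S, dist (f x) (f y) ≤ ε := by
  constructor
  · intro h ε hε
    obtain ⟨A, ⟨B, hB, rfl⟩, hcl, hcov, hd⟩ := h ε hε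
    refine ⟨B, hB, fun n S hS => hcl S (mem_iUnion.2 ⟨n, hS⟩), fun x => ?_, fun n S hS =>
      (ediam_image_le_ofReal_iff hε.le).1 (hd S (mem_iUnion.2 ⟨n, hS⟩))⟩
    obtain ⟨S, hS, hx⟩ := mem_sUnion.1 (hcov ▸ mem_univ x)
    obtain ⟨n, hn⟩ := mem_iUnion.1 hS
    exact ⟨n, S, hn, hx⟩
  · intro h ε hε
    obtain ⟨B, hB, hcl, hcov, hd⟩ := h ε hε
    refine ⟨⋃ n, B n, ⟨B, hB, rfl⟩, fun S hS => ?_, eq_univ_of_forall fun x => ?_,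
      fun S hS => ?_⟩
    · obtain ⟨n, hn⟩ := mem_iUnion.1 hS
      exact hcl n S hn
    · obtain ⟨n, S, hS, hx⟩ := hcov x
      exact ⟨S, mem_iUnion.2 ⟨n, hS⟩, hx⟩
    · obtain ⟨n, hn⟩ := mem_iUnion.1 hS
      exact (ediam_image_le_ofReal_iff hε.le).2 (hd n S hn)

end Characterizations

/-! ### Discrete and σ-discrete families -/

section DiscreteFamilies

variable {X : Type u} [TopologicalSpace X] {A : Set (Set X)}

theorem IsDiscreteFamily.mono {B : Set (Set X)} (hA : IsDiscreteFamily A) (h : B ⊆ A) :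
    IsDiscreteFamily B := fun x =>
  let ⟨U, hU, hd⟩ := hA x
  ⟨U, hU, fun S hS T hT => hd S (h hS) T (h hT)⟩

theorem IsDiscreteFamily.isClosed_sUnion (hA : IsDiscreteFamily A)
    (hc : ∀ S ∈ A, IsClosed S) : IsClosed (⋃₀ A) := by
  rw [sUnion_eq_iUnion]
  refine LocallyFinite.isClosed_iUnion (fun x => ?_) fun S => hc S S.2
  obtain ⟨U, hU, hd⟩ := hA x
  exact ⟨U, hU, Set.Subsingleton.finite fun S hS T hT => Subtype.ext (hd S S.2 T T.2 hS hT)⟩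

/-- The image of a discrete family under a set operation which shrinks its members. -/
theorem IsDiscreteFamily.image_of_subset (hA : IsDiscreteFamily A) {g : Set X → Set X}
    (hg : ∀ S, g S ⊆ S) : IsDiscreteFamily (g '' A) := by
  intro x
  obtain ⟨U, hU, hd⟩ := hA x
  refine ⟨U, hU, ?_⟩
  rintro _ ⟨S, hS, rfl⟩ _ ⟨T, hT, rfl⟩ h₁ h₂
  rw [hd S hS T hT (h₁.mono (inter_subset_inter_left _ (hg S)))
    (h₂.mono (inter_subset_inter_left _ (hg T)))]

theorem IsDiscreteFamily.preimage {Z : Type v} [TopologicalSpace Z] (hA : IsDiscreteFamily A)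
    {g : Z → X} (hg : Continuous g) : IsDiscreteFamily ((fun S => g ⁻¹' S) '' A) := by
  intro z
  obtain ⟨U, hU, hd⟩ := hA (g z)
  refine ⟨g ⁻¹' U, hg.continuousAt hU, ?_⟩
  rintro _ ⟨S, hS, rfl⟩ _ ⟨T, hT, rfl⟩ ⟨a, ha⟩ ⟨b, hb⟩
  exact congrArg (fun S => g ⁻¹' S) (hd S hS T hT ⟨g a, ha⟩ ⟨g b, hb⟩)

theorem IsDiscreteFamily.countable [SecondCountableTopology X] (hA : IsDiscreteFamily A) :
    A.Countable := by
  choose U hU hd using hA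
  obtain ⟨s, hs, hcov⟩ := TopologicalSpace.countable_cover_nhds hU
  have hsub : ∀ x, {S ∈ A | (S ∩ U x).Nonempty}.Countable := fun x =>
    Set.Subsingleton.countable fun S hS T hT => hd x S hS.1 T hT.1 hS.2 hT.2
  -- The empty set may be a member yet meets no neighbourhood, so it is counted separately.
  refine ((hs.biUnion fun x _ => hsub x).union (countable_singleton ∅)).mono fun S hS => ?_
  rcases S.eq_empty_or_nonempty with rfl | ⟨y, hy⟩
  · exact Or.inr rfl
  · obtain ⟨x, hx, hyx⟩ := mem_iUnion₂.1 (hcov ▸ mem_univ y)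
    exact Or.inl (mem_iUnion₂.2 ⟨x, hx, hS, y, hy, hyx⟩)

/-- A metric space has a σ-discrete closed cover by sets of small diameter. -/
theorem exists_sigmaDiscrete_closed_cover (X : Type u) [MetricSpace X] {r : ℝ} (hr : 0 < r) :
    ∃ B : ℕ → Set (Set X), (∀ n, IsDiscreteFamily (B n)) ∧ (∀ n, ∀ S ∈ B n, IsClosed S) ∧
      (∀ x, ∃ n, ∃ S ∈ B n, x ∈ S) ∧ ∀ n, ∀ S ∈ B n, ∀ x ∈ S, ∀ y ∈ S, dist x y < r := by
  classical
  obtain ⟨_, wf⟩ := exists_wellFoundedLT X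
  -- Stone's construction: `x` is the first centre within `r / 2` of `y`, with margin `1 / (k + 1)`.
  -- The margin separates the pieces of different centres.
  let D : ℕ → X → Set X := fun k x =>
    {y | dist x y ≤ r / 2 - 1 / (k + 1 : ℝ) ∧ ∀ z < x, r / 2 ≤ dist z y}
  have hpos : ∀ k : ℕ, (0 : ℝ) < 1 / (k + 1 : ℝ) := fun k => Nat.one_div_pos_of_nat
  have hsep : ∀ k x x' y y', y ∈ D k x → y' ∈ D k x' → x < x' →
      1 / (k + 1 : ℝ) ≤ dist y y' := by
    intro k x x' y y' hy hy' hlt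
    linarith [hy.1, hy'.2 x hlt, dist_triangle x y y']
  refine ⟨fun k => range (D k), fun k x => ?_, ?_, fun y => ?_, ?_⟩
  · refine ⟨Metric.ball x (1 / (k + 1 : ℝ) / 2), Metric.ball_mem_nhds _ (half_pos (hpos k)), ?_⟩
    rintro _ ⟨a, rfl⟩ _ ⟨b, rfl⟩ ⟨y, hy, hyx⟩ ⟨z, hz, hzx⟩
    rw [Metric.mem_ball] at hyx hzx
    have hyz : dist y z < 1 / (k + 1 : ℝ) := by
      linarith [dist_triangle_right y z x]
    rcases lt_trichotomy a b with h | h | h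
    · exact absurd (hsep k a b y z hy hz h) hyz.not_ge
    · rw [h]
    · exact absurd (hsep k b a z y hz hy h) (dist_comm y z ▸ hyz).not_ge
  · rintro k _ ⟨x, rfl⟩
    have hdist : ∀ z : X, Continuous fun y => dist z y := fun z => by fun_prop
    have heq : D k x = {y | dist x y ≤ r / 2 - 1 / (k + 1 : ℝ)} ∩
        ⋂ z, ⋂ _ : z < x, {y | r / 2 ≤ dist z y} := by
      ext y
      simp [D]
    rw [heq]
    exact (isClosed_le (hdist x) continuous_const).inter (isClosed_iInter fun z =>
      isClosed_iInter fun _ => isClosed_le continuous_const (hdist z))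
  · have hne : {x | dist x y < r / 2}.Nonempty := ⟨y, by simpa using hr⟩
    let x := wellFounded_lt.min _ hne
    have hx : dist x y < r / 2 := wellFounded_lt.min_mem _ hne
    obtain ⟨k, hk⟩ := exists_nat_one_div_lt (sub_pos.2 hx)
    refine ⟨k, _, ⟨x, rfl⟩, by linarith, fun z hz => ?_⟩
    by_contra! h
    exact wellFounded_lt.not_lt_min {x | dist x y < r / 2} h hz
  · rintro k _ ⟨x, rfl⟩ a ha b hb
    linarith [ha.1, hb.1, hpos k, dist_triangle_left a b x]

end DiscreteFamilies

/-! ### Operations on `F_σ` sets -/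

section FSigma

variable {X : Type u} [TopologicalSpace X]

theorem IsFSigmaSet.preimage {Z : Type v} [TopologicalSpace Z] {S : Set X} (hS : IsFSigmaSet S)
    {g : Z → X} (hg : Continuous g) : IsFSigmaSet (g ⁻¹' S) := by
  obtain ⟨C, hC, rfl⟩ := hS
  exact ⟨fun n => g ⁻¹' C n, fun n => (hC n).preimage hg, preimage_iUnion⟩

theorem isFSigmaSet_iUnion_prod {C : ℕ → ℕ → Set X} (hC : ∀ m n, IsClosed (C m n)) :
    IsFSigmaSet (⋃ m, ⋃ n, C m n) :=
  ⟨fun k => C k.unpair.1 k.unpair.2, fun _ => hC _ _, (iUnion_unpair C).symm⟩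

end FSigma

/-! ### Implications without Baire category -/

section General

variable {X : Type u} {Y : Type v} [TopologicalSpace X] [MetricSpace Y] {f : X → Y}

theorem Fragmentable.cliquish (h : Fragmentable f) : Cliquish f := by
  rw [fragmentable_iff] at h
  rw [cliquish_iff]
  intro ε hε U hU hne
  -- An open set meeting `closure U` already meets `U`.
  obtain ⟨W, hW, hWne, hd⟩ := h ε hε (closure U) isClosed_closure hne.closure
  obtain ⟨x, hxW, hxU⟩ := hWne
  exact ⟨W ∩ U, hW.inter hU, mem_closure_iff.1 hxU W hW hxW, inter_subset_right,
    fun a ha b hb => hd a ⟨ha.1, subset_closure ha.2⟩ b ⟨hb.1, subset_closure hb.2⟩⟩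

/-- The transfinite sequence in which each term is selected by `W` from the complement of the
union of the preceding ones. -/
noncomputable def transfiniteSelection (W : Set X → Set X) (α : Ordinal.{u}) : Set X :=
  W (⋃ β : Iio α, transfiniteSelection W β.1)ᶜ
termination_by α
decreasing_by exact β.2

/-- A point never reached keeps every remainder nonempty, so each stage picks up a new point; this
would inject the ordinals into `X`. -/
theorem exists_mem_transfiniteSelection {W : Set X → Set X} (hW : ∀ F, IsOpen (W F))
    (hne : ∀ F, IsClosed F → F.Nonempty → (W F ∩ F).Nonempty) (x : X) :
    ∃ α, x ∈ transfiniteSelection W α := by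
  have hopen : ∀ α, IsOpen (transfiniteSelection W α) := fun α => by
    rw [transfiniteSelection]; exact hW _
  by_contra! hx
  have hsel : ∀ α, ∃ y, y ∈ transfiniteSelection W α ∧
      ∀ β < α, y ∉ transfiniteSelection W β := by
    intro α
    obtain ⟨y, hy, hy'⟩ := hne (⋃ β : Iio α, transfiniteSelection W β.1)ᶜ
      (isOpen_iUnion fun β => hopen _).isClosed_compl ⟨x, by simpa using fun β _ => hx β⟩
    refine ⟨y, by rwa [transfiniteSelection], fun β hβ h => hy' (mem_iUnion.2 ⟨⟨β, hβ⟩, h⟩)⟩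
  choose y hy hy' using hsel
  refine not_injective_of_ordinal y fun α β hαβ => ?_
  rcases lt_trichotomy α β with h | h | h
  · exact absurd (hαβ ▸ hy α) (hy' β α h)
  · exact h
  · exact absurd (hαβ ▸ hy β) (hy' α β h)

theorem Fragmentable.weaklySeparated (h : Fragmentable f) : WeaklySeparated f := by
  rw [fragmentable_iff] at h
  intro ε hε
  have hex : ∀ F : Set X, ∃ U : Set X, IsOpen U ∧ (IsClosed F → F.Nonempty → (U ∩ F).Nonempty) ∧
      (IsClosed F → ∀ x ∈ U ∩ F, ∀ y ∈ U ∩ F, dist (f x) (f y) ≤ ε / 2) := by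
    intro F
    by_cases hF : IsClosed F ∧ F.Nonempty
    · obtain ⟨U, hU, hne, hd⟩ := h (ε / 2) (half_pos hε) F hF.1 hF.2
      exact ⟨U, hU, fun _ _ => hne, fun _ => hd⟩
    · exact ⟨∅, isOpen_empty, fun h₁ h₂ => absurd ⟨h₁, h₂⟩ hF, by simp⟩
  choose W hW hne hd using hex
  have hopen : ∀ α, IsOpen (transfiniteSelection W α) := fun α => by
    rw [transfiniteSelection]; exact hW _
  have hcov := exists_mem_transfiniteSelection hW hne
  let rank : X → Ordinal.{u} := fun x => sInf {α | x ∈ transfiniteSelection W α}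
  have hmem : ∀ x, x ∈ transfiniteSelection W (rank x) := fun x => csInf_mem (hcov x)
  have hle : ∀ x α, x ∈ transfiniteSelection W α → rank x ≤ α := fun x α hx => csInf_le' hx
  have hF : ∀ x, x ∈ W (⋃ β : Iio (rank x), transfiniteSelection W β.1)ᶜ ∩
      (⋃ β : Iio (rank x), transfiniteSelection W β.1)ᶜ := by
    refine fun x => ⟨?_, fun hx => ?_⟩
    · have := hmem x
      rwa [transfiniteSelection] at this
    · obtain ⟨β, hβ⟩ := mem_iUnion.1 hx
      exact (hle x _ hβ).not_gt β.2
  refine ⟨fun x => transfiniteSelection W (rank x), fun x => ⟨hopen _, hmem x⟩,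
    fun x y hxy hyx => ?_⟩
  -- Each point lies in the set selected at the other's first stage, so both are new at the same
  -- stage.
  have hr : rank x = rank y := le_antisymm (hle x _ hxy) (hle y _ hyx)
  have hy := hF y
  rw [← hr] at hy
  exact (hd _ (isOpen_iUnion fun β => hopen _).isClosed_compl x (hF x) y hy).trans_lt
    (half_lt_self hε)

theorem GeneralizedLebesgueProperty.weaklySeparated (h : GeneralizedLebesgueProperty f) :
    WeaklySeparated f := by
  classical
  rw [generalizedLebesgueProperty_iff] at h
  intro ε hε
  obtain ⟨B, hB, hcl, hcov, hd⟩ := h (ε / 2) (half_pos hε)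
  have hclosed : ∀ n, IsClosed (⋃₀ B n) := fun n => (hB n).isClosed_sUnion (hcl n)
  have hcov' : ∀ x, ∃ n, x ∈ ⋃₀ B n := hcov
  let N : X → ℕ := fun x => Nat.find (hcov' x)
  have hN : ∀ x, x ∈ ⋃₀ B (N x) := fun x => Nat.find_spec (hcov' x)
  have hW : ∀ n x, ∃ U : Set X, IsOpen U ∧ x ∈ U ∧
      ∀ S ∈ B n, ∀ T ∈ B n, (S ∩ U).Nonempty → (T ∩ U).Nonempty → S = T := by
    intro n x
    obtain ⟨U, hU, hUd⟩ := hB n x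
    exact ⟨interior U, isOpen_interior, mem_interior_iff_mem_nhds.2 hU, fun S hS T hT h₁ h₂ =>
      hUd S hS T hT (h₁.mono (inter_subset_inter_right _ interior_subset))
        (h₂.mono (inter_subset_inter_right _ interior_subset))⟩
  choose W hWo hxW hWd using hW
  -- The neighbourhood of `x` avoids the families preceding the first one that covers `x`, and meets
  -- at most one member of that one.
  refine ⟨fun x => W (N x) x ∩ ⋂ m ∈ Iio (N x), (⋃₀ B m)ᶜ, fun x =>
    ⟨(hWo _ _).inter ((finite_Iio _).isOpen_biInter fun m _ => (hclosed m).isOpen_compl),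
      hxW _ _, mem_iInter₂.2 fun m hm => Nat.find_min (hcov' x) hm⟩, fun x y hxy hyx => ?_⟩
  have hle : ∀ a b, a ∈ ⋂ m ∈ Iio (N b), (⋃₀ B m)ᶜ → N b ≤ N a := fun a b hab =>
    not_lt.1 fun hlt => mem_iInter₂.1 hab (N a) hlt (hN a)
  have hNxy : N x = N y := le_antisymm (hle y x hyx.2) (hle x y hxy.2)
  obtain ⟨S, hS, hxS⟩ := hN x
  obtain ⟨T, hT, hyT⟩ := hN y
  rw [← hNxy] at hT
  have hST : S = T := hWd (N x) x S hS T hT ⟨x, hxS, hxW _ _⟩ ⟨y, hyT, hyx.1⟩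
  exact (hd _ S hS x hxS y (hST ▸ hyT)).trans_lt (half_lt_self hε)

theorem LebesgueProperty.generalizedLebesgueProperty (h : LebesgueProperty f) :
    GeneralizedLebesgueProperty f := by
  intro ε hε
  obtain ⟨C, hC, hcov, hd⟩ := h ε hε
  refine ⟨range C, ⟨fun n => {C n}, fun n x => ⟨univ, Filter.univ_mem, ?_⟩, ?_⟩,
    forall_mem_range.2 hC, by rwa [sUnion_range], forall_mem_range.2 hd⟩
  · rintro _ rfl _ rfl _ _
    rfl
  · ext S
    simp [eq_comm]

theorem PointOfContinuityProperty.fragmentable (h : PointOfContinuityProperty f) :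
    Fragmentable f := by
  rw [fragmentable_iff]
  intro ε hε F hF hne
  obtain ⟨x, hx⟩ := h F hF hne
  obtain ⟨V, hV, hVo, hxV⟩ := mem_nhds_iff.1 (hx (Metric.ball_mem_nhds _ (half_pos hε)))
  obtain ⟨U, hU, rfl⟩ := isOpen_induced_iff.1 hVo
  refine ⟨U, hU, ⟨x, hxV, x.2⟩, fun a ha b hb => ?_⟩
  have ha' : dist (f a) (f x) < ε / 2 := hV (a := ⟨a, ha.2⟩) ha.1
  have hb' : dist (f b) (f x) < ε / 2 := hV (a := ⟨b, hb.2⟩) hb.1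
  linarith [dist_triangle_right (f a) (f b) (f x)]

theorem PointwiseDiscontinuous.cliquish (h : PointwiseDiscontinuous f) : Cliquish f := by
  rw [cliquish_iff]
  intro ε hε U hU hne
  obtain ⟨x, hx⟩ := h U hU hne
  obtain ⟨V, hV, hVo, hxV⟩ := mem_nhds_iff.1 (hx (Metric.ball_mem_nhds _ (half_pos hε)))
  obtain ⟨O, hO, rfl⟩ := isOpen_induced_iff.1 hVo
  refine ⟨O ∩ U, hO.inter hU, ⟨x, hxV, x.2⟩, inter_subset_right, fun a ha b hb => ?_⟩
  have ha' : dist (f a) (f x) < ε / 2 := hV (a := ⟨a, ha.2⟩) ha.1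
  have hb' : dist (f b) (f x) < ε / 2 := hV (a := ⟨b, hb.2⟩) hb.1
  linarith [dist_triangle_right (f a) (f b) (f x)]

theorem GeneralizedLebesgueProperty.borelOne (h : GeneralizedLebesgueProperty f) :
    BorelOne f := by
  rw [generalizedLebesgueProperty_iff] at h
  intro V hV
  choose B hB hcl hcov hd using fun k : ℕ => h (1 / (k + 1 : ℝ)) Nat.one_div_pos_of_nat
  -- A member through `x` whose image is small compared with the room around `f x` in `V` lies
  -- wholly in `f ⁻¹' V`.
  have heq : f ⁻¹' V = ⋃ k, ⋃ n, ⋃₀ {S ∈ B k n | S ⊆ f ⁻¹' V} := by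
    refine Subset.antisymm (fun x hx => ?_)
      (iUnion_subset fun k => iUnion_subset fun n => sUnion_subset fun S hS => hS.2)
    obtain ⟨r, hr, hrV⟩ := Metric.isOpen_iff.1 hV _ hx
    obtain ⟨k, hk⟩ := exists_nat_one_div_lt hr
    obtain ⟨n, S, hS, hxS⟩ := hcov k x
    exact mem_iUnion₂.2 ⟨k, n, S, ⟨hS, fun y hy =>
      hrV ((hd k n S hS y hy x hxS).trans_lt hk)⟩, hxS⟩
  rw [heq]
  exact isFSigmaSet_iUnion_prod fun k n =>
    ((hB k n).mono (sep_subset _ _)).isClosed_sUnion fun S hS => hcl k n S hS.1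

theorem BorelOne.lebesgueProperty [TopologicalSpace.SeparableSpace Y] (h : BorelOne f) :
    LebesgueProperty f := by
  rw [lebesgueProperty_iff]
  intro ε hε
  obtain ⟨s, hs, hdense⟩ := TopologicalSpace.exists_countable_dense Y
  choose C hC hCeq using fun q : Y => h (Metric.ball q (ε / 2)) Metric.isOpen_ball
  refine ⟨⋃ q ∈ s, range (C q), hs.biUnion fun q _ => countable_range _, ?_, fun x => ?_, ?_⟩
  · simp only [mem_iUnion₂]
    rintro _ ⟨q, -, n, rfl⟩
    exact hC q n
  · obtain ⟨q, hq, hxq⟩ := hdense.exists_dist_lt (f x) (half_pos hε)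
    have hx : x ∈ f ⁻¹' Metric.ball q (ε / 2) := hxq
    rw [hCeq] at hx
    obtain ⟨n, hn⟩ := mem_iUnion.1 hx
    exact ⟨C q n, mem_iUnion₂.2 ⟨q, hq, mem_range_self n⟩, hn⟩
  · simp only [mem_iUnion₂]
    rintro _ ⟨q, -, n, rfl⟩ x hx y hy
    have hball : ∀ z ∈ C q n, dist (f z) q < ε / 2 := fun z hz => by
      have : z ∈ f ⁻¹' Metric.ball q (ε / 2) := hCeq q ▸ mem_iUnion.2 ⟨n, hz⟩
      exact this
    linarith [hball x hx, hball y hy, dist_triangle_right (f x) (f y) q]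

theorem GeneralizedLebesgueProperty.lebesgueProperty [SecondCountableTopology X]
    (h : GeneralizedLebesgueProperty f) : LebesgueProperty f := by
  rw [generalizedLebesgueProperty_iff] at h
  rw [lebesgueProperty_iff]
  intro ε hε
  obtain ⟨B, hB, hcl, hcov, hd⟩ := h ε hε
  refine ⟨⋃ n, B n, countable_iUnion fun n => (hB n).countable, fun S hS => ?_, fun x => ?_,
    fun S hS => ?_⟩
  · obtain ⟨n, hn⟩ := mem_iUnion.1 hS
    exact hcl n S hn
  · obtain ⟨n, S, hS, hx⟩ := hcov x
    exact ⟨S, mem_iUnion.2 ⟨n, hS⟩, hx⟩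
  · obtain ⟨n, hn⟩ := mem_iUnion.1 hS
    exact hd n S hn

end General

/-! ### Category arguments -/

section Baire

variable {X : Type u} {Y : Type v} [TopologicalSpace X] [MetricSpace Y] {f : X → Y}

theorem GeneralizedLebesgueProperty.cliquish [BaireSpace X]
    (h : GeneralizedLebesgueProperty f) : Cliquish f := by
  rw [generalizedLebesgueProperty_iff] at h
  rw [cliquish_iff]
  intro ε hε U hU hne
  obtain ⟨B, hB, hcl, hcov, hd⟩ := h ε hε
  obtain ⟨x, hxU, hx⟩ := (dense_iUnion_interior_of_closed
    (fun n => (hB n).isClosed_sUnion (hcl n))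
    (eq_univ_of_forall fun x => mem_iUnion.2 (hcov x))).inter_open_nonempty U hU hne
  obtain ⟨n, hn⟩ := mem_iUnion.1 hx
  obtain ⟨W, hW, hWd⟩ := hB n x
  refine ⟨interior W ∩ (U ∩ interior (⋃₀ B n)),
    isOpen_interior.inter (hU.inter isOpen_interior),
    ⟨x, mem_interior_iff_mem_nhds.2 hW, hxU, hn⟩, fun y hy => hy.2.1, fun a ha b hb => ?_⟩
  obtain ⟨S, hS, haS⟩ := interior_subset ha.2.2
  obtain ⟨T, hT, hbT⟩ := interior_subset hb.2.2
  have hST : S = T :=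
    hWd S hS T hT ⟨a, haS, interior_subset ha.1⟩ ⟨b, hbT, interior_subset hb.1⟩
  exact hd n S hS a haS b (hST ▸ hbT)

/-- The points with a neighbourhood of oscillation at most `1 / (k + 1)` form a dense open set, and
`f` is continuous on the intersection over `k`. The Baire property is needed only to make this
residual set dense. -/
theorem Cliquish.eventually_residual_continuousAt (h : Cliquish f) :
    ∀ᶠ x in residual X, ContinuousAt f x := by
  rw [cliquish_iff] at h
  let G : ℕ → Set X := fun k =>
    ⋃₀ {O | IsOpen O ∧ ∀ x ∈ O, ∀ y ∈ O, dist (f x) (f y) ≤ 1 / (k + 1 : ℝ)}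
  have hG : ∀ k, ∀ᶠ x in residual X, x ∈ G k := fun k => by
    refine residual_of_dense_open (isOpen_sUnion fun O hO => hO.1)
      (dense_iff_inter_open.2 fun U hU hne => ?_)
    obtain ⟨O, hO, ⟨x, hx⟩, hOU, hd⟩ := h _ (Nat.one_div_pos_of_nat (n := k)) U hU hne
    exact ⟨x, hOU hx, O, ⟨hO, hd⟩, hx⟩
  filter_upwards [eventually_countable_forall.2 hG] with x hx
  refine Metric.tendsto_nhds.2 fun ε hε => ?_
  obtain ⟨k, hk⟩ := exists_nat_one_div_lt hε
  obtain ⟨O, ⟨hO, hd⟩, hxO⟩ := hx k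
  filter_upwards [hO.mem_nhds hxO] with y hy
  exact (hd y hy x hxO).trans_lt hk

theorem Cliquish.pointwiseDiscontinuous [BaireSpace X] (h : Cliquish f) :
    PointwiseDiscontinuous f := by
  intro U hU hne
  obtain ⟨x, hxU, hx⟩ := (dense_of_mem_residual
    h.eventually_residual_continuousAt).inter_open_nonempty U hU hne
  have hx' : ContinuousAt f x := hx
  exact ⟨⟨x, hxU⟩, ContinuousAt.comp (x := (⟨x, hxU⟩ : U)) hx' continuousAt_subtype_val⟩

theorem Fragmentable.domRestrict (h : Fragmentable f) {F : Set X} (hF : IsClosed F) :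
    Fragmentable (F.domRestrict f) := by
  rw [fragmentable_iff] at h ⊢
  intro ε hε G hG hne
  obtain ⟨U, hU, ⟨_, hxU, ⟨x, hx, rfl⟩⟩, hd⟩ := h ε hε (Subtype.val '' G)
    (hF.isClosedEmbedding_subtypeVal.isClosedMap G hG) (hne.image _)
  exact ⟨Subtype.val ⁻¹' U, hU.preimage continuous_subtype_val, ⟨x, hxU, hx⟩, fun a ha b hb =>
    hd a ⟨ha.1, a, ha.2, rfl⟩ b ⟨hb.1, b, hb.2, rfl⟩⟩

theorem GeneralizedLebesgueProperty.domRestrict (h : GeneralizedLebesgueProperty f) (F : Set X) :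
    GeneralizedLebesgueProperty (F.domRestrict f) := by
  rw [generalizedLebesgueProperty_iff] at h ⊢
  intro ε hε
  obtain ⟨B, hB, hcl, hcov, hd⟩ := h ε hε
  refine ⟨fun n => (fun S => Subtype.val ⁻¹' S) '' B n,
    fun n => (hB n).preimage continuous_subtype_val, ?_, fun x => ?_, ?_⟩
  · rintro n _ ⟨S, hS, rfl⟩
    exact (hcl n S hS).preimage continuous_subtype_val
  · obtain ⟨n, S, hS, hx⟩ := hcov x
    exact ⟨n, _, mem_image_of_mem _ hS, hx⟩
  · rintro n _ ⟨S, hS, rfl⟩ x hx y hy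
    exact hd n S hS x hx y hy

theorem Fragmentable.pointOfContinuityProperty (hX : IsHereditarilyBaire X)
    (h : Fragmentable f) : PointOfContinuityProperty f := by
  intro F hF hne
  have : BaireSpace F := hX F hF
  have : Nonempty F := hne.to_subtype
  exact (dense_of_mem_residual
    (h.domRestrict hF).cliquish.eventually_residual_continuousAt).nonempty

theorem GeneralizedLebesgueProperty.fragmentable (hX : IsHereditarilyBaire X)
    (h : GeneralizedLebesgueProperty f) : Fragmentable f := by
  rw [fragmentable_iff]
  intro ε hε F hF hne
  have : BaireSpace F := hX F hF
  have : Nonempty F := hne.to_subtype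
  obtain ⟨O, hO, ⟨x, hx⟩, -, hd⟩ :=
    cliquish_iff.1 (h.domRestrict F).cliquish ε hε univ isOpen_univ univ_nonempty
  obtain ⟨U, hU, rfl⟩ := isOpen_induced_iff.1 hO
  exact ⟨U, hU, ⟨x, hx, x.2⟩, fun a ha b hb => hd ⟨a, ha.2⟩ ha.1 ⟨b, hb.2⟩ hb.1⟩

/-- A continuous real function of a function of the first Borel class on a Baire space is
continuous at most points. -/
theorem BorelOne.eventually_residual_continuousAt_comp [BaireSpace X] (h : BorelOne f)
    {φ : Y → ℝ} (hφ : Continuous φ) : ∀ᶠ x in residual X, ContinuousAt (fun x => φ (f x)) x :=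
  have hb : BorelOne fun x => φ (f x) := fun V hV => h (φ ⁻¹' V) (hV.preimage hφ)
  -- The separability used here is that of `ℝ`, so `Y` may be arbitrary.
  hb.lebesgueProperty.generalizedLebesgueProperty.cliquish.eventually_residual_continuousAt

end Baire

/-! ### Metric domains -/

section Metric

variable {X : Type u} {Y : Type v} [MetricSpace X] [MetricSpace Y] {f : X → Y}

theorem weaklySeparated_iff_ltzProperty : WeaklySeparated f ↔ LTZProperty f := by
  constructor
  · intro h ε hε
    obtain ⟨V, hV, hd⟩ := h ε hε
    choose δ hδ hball using fun x => Metric.isOpen_iff.1 (hV x).1 x (hV x).2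
    exact ⟨δ, hδ, fun x y hxy => hd x y (hball y (hxy.trans_le (min_le_right _ _)))
      (hball x (Metric.mem_ball'.2 (hxy.trans_le (min_le_left _ _))))⟩
  · intro h ε hε
    obtain ⟨δ, hδ, hd⟩ := h ε hε
    exact ⟨fun x => Metric.ball x (δ x), fun x => ⟨Metric.isOpen_ball, Metric.mem_ball_self (hδ x)⟩,
      fun x y hxy hyx => hd x y (lt_min (Metric.mem_ball'.1 hyx) hxy)⟩

theorem LTZProperty.generalizedLebesgueProperty (h : LTZProperty f) :
    GeneralizedLebesgueProperty f := by
  rw [generalizedLebesgueProperty_iff]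
  intro ε hε
  obtain ⟨δ, hδ, hd⟩ := h (ε / 3) (by positivity)
  let E : ℕ → Set X := fun n => closure {x | 1 / (n + 1 : ℝ) ≤ δ x}
  have hE : ∀ n, ∀ x ∈ E n, ∀ y ∈ E n, dist x y < 1 / (n + 1 : ℝ) → dist (f x) (f y) ≤ ε := by
    intro n x hx y hy hxy
    have happrox : ∀ z ∈ E n, ∀ η > 0, ∃ z', 1 / (n + 1 : ℝ) ≤ δ z' ∧ dist z z' < η ∧
        dist (f z) (f z') < ε / 3 := by
      intro z hz η hη
      -- Closeness below `δ z` and `1 / (n + 1) ≤ δ z'` lets (LTZ) compare `f z` with `f z'`, so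
      -- passing to the closure costs `ε / 3` at each end.
      have hm : 0 < min η (min (δ z) (1 / (n + 1 : ℝ))) :=
        lt_min hη (lt_min (hδ z) Nat.one_div_pos_of_nat)
      obtain ⟨z', hz', hzz'⟩ := Metric.mem_closure_iff.1 hz _ hm
      have h₂ := hzz'.trans_le (min_le_right _ _)
      exact ⟨z', hz', hzz'.trans_le (min_le_left _ _), hd _ _
        (h₂.trans_le (min_le_min_left _ hz'))⟩
    have hη : 0 < (1 / (n + 1 : ℝ) - dist x y) / 2 := half_pos (sub_pos.2 hxy)
    obtain ⟨x', hx', hxx', hfx⟩ := happrox x hx _ hη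
    obtain ⟨y', hy', hyy', hfy⟩ := happrox y hy _ hη
    have hxy' : dist x' y' < 1 / (n + 1 : ℝ) := by
      linarith [dist_triangle4 x' x y y', dist_comm x x']
    linarith [hd x' y' (lt_min (hxy'.trans_le hx') (hxy'.trans_le hy')),
      dist_triangle4 (f x) (f x') (f y') (f y), dist_comm (f y) (f y')]
  choose D hD hcl hcov hdiam using fun n : ℕ =>
    exists_sigmaDiscrete_closed_cover X (Nat.one_div_pos_of_nat (α := ℝ) (n := n))
  refine ⟨fun k => (fun S => E k.unpair.1 ∩ S) '' D k.unpair.1 k.unpair.2,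
    fun k => (hD _ _).image_of_subset fun S => inter_subset_right, ?_, fun x => ?_, ?_⟩
  · rintro k _ ⟨S, hS, rfl⟩
    exact isClosed_closure.inter (hcl _ _ S hS)
  · obtain ⟨n, hn⟩ := exists_nat_one_div_lt (hδ x)
    obtain ⟨m, S, hS, hx⟩ := hcov n x
    refine ⟨Nat.pair n m, E n ∩ S, ⟨S, ?_, ?_⟩, subset_closure hn.le, hx⟩ <;> simp [hS]
  · rintro k _ ⟨S, hS, rfl⟩ x hx y hy
    exact hE _ x hx.1 y hy.1 (hdiam _ _ S hS x hx.2 y hy.2)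

theorem generalizedLebesgueProperty_iff_ltzProperty :
    GeneralizedLebesgueProperty f ↔ LTZProperty f :=
  ⟨fun h => weaklySeparated_iff_ltzProperty.1 h.weaklySeparated,
    LTZProperty.generalizedLebesgueProperty⟩

theorem WeaklySeparated.generalizedLebesgueProperty (h : WeaklySeparated f) :
    GeneralizedLebesgueProperty f :=
  (weaklySeparated_iff_ltzProperty.1 h).generalizedLebesgueProperty

/-- A function which is not fragmentable oscillates at every point of some nonempty countable
set, relative to that set. -/
theorem exists_countable_oscillation_of_not_fragmentable (h : ¬ Fragmentable f) :
    ∃ ε > 0, ∃ D : Set X, D.Countable ∧ D.Nonempty ∧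
      ∀ x ∈ D, ∀ r > 0, ∃ y ∈ D, dist y x < r ∧ ε ≤ dist (f y) (f x) := by
  rw [fragmentable_iff] at h
  push Not at h
  obtain ⟨ε, hε, F, -, ⟨x₀, hx₀⟩, hF⟩ := h
  have hstep : ∀ (x : F) (n : ℕ), ∃ y : F, dist (y : X) x < 1 / (n + 1 : ℝ) ∧
      ε / 2 ≤ dist (f y) (f x) := by
    intro x n
    obtain ⟨a, ha, b, hb, hab⟩ := hF (Metric.ball x (1 / (n + 1 : ℝ))) Metric.isOpen_ball
      ⟨x, Metric.mem_ball_self Nat.one_div_pos_of_nat, x.2⟩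
    by_contra! hcon
    linarith [hcon ⟨a, ha.2⟩ ha.1, hcon ⟨b, hb.2⟩ hb.1, dist_triangle_right (f a) (f b) (f x)]
  choose next hdist hosc using hstep
  -- Finite lists index all iterates of `next`: a countable set closed under every choice of an
  -- oscillation witness.
  let walk : List ℕ → F := fun l => l.foldr (fun n x => next x n) ⟨x₀, hx₀⟩
  refine ⟨ε / 2, half_pos hε, range fun l => (walk l : X), countable_range _,
    range_nonempty _, ?_⟩
  rintro _ ⟨l, rfl⟩ r hr
  obtain ⟨n, hn⟩ := exists_nat_one_div_lt hr
  exact ⟨_, ⟨n :: l, rfl⟩, (hdist (walk l) n).trans hn, hosc (walk l) n⟩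

/-- At a generic `x` of `closure D`, the distances from `f` to `f '' D` and to each `f q` are
continuous. The first vanishes on the dense set `D`, so some `f q` is near `f x`, and then near `f`
at all points of `D` close to `x`. This contradicts the oscillation on `D`. -/
theorem BorelOne.fragmentable (hX : IsHereditarilyBaire X) (h : BorelOne f) :
    Fragmentable f := by
  by_contra hcon
  obtain ⟨ε, hε, D, hDc, hDne, hosc⟩ := exists_countable_oscillation_of_not_fragmentable hcon
  have : BaireSpace (closure D) := hX _ isClosed_closure
  have : Nonempty (closure D) := hDne.closure.to_subtype
  have : Countable D := hDc.to_subtype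
  have hb : BorelOne fun x : closure D => f x := fun V hV =>
    (h V hV).preimage continuous_subtype_val
  obtain ⟨x, hinf, hx⟩ := (dense_of_mem_residual
    ((hb.eventually_residual_continuousAt_comp (Metric.continuous_infDist_pt (f '' D))).and
      (eventually_countable_forall.2 fun q : D =>
        hb.eventually_residual_continuousAt_comp
          (continuous_id.dist (continuous_const (y := f q)))))).nonempty
  -- every neighbourhood of `x` contains points of `D`
  have hnear : ∀ p : closure D → Prop, (∀ᶠ y in 𝓝 x, p y) →
      ∃ r > 0, ∃ z ∈ D, dist z x < r ∧ ∀ y (hy : y ∈ D), dist y x < r → p ⟨y, subset_closure hy⟩ := by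
    intro p hp
    obtain ⟨r, hr, hball⟩ := Metric.eventually_nhds_iff.1 hp
    obtain ⟨z, hz, hxz⟩ := Metric.mem_closure_iff.1 x.2 r hr
    exact ⟨r, hr, z, hz, dist_comm (x : X) z ▸ hxz, fun y hy hyx => hball hyx⟩
  have hzero : Metric.infDist (f x) (f '' D) < ε / 8 := by
    by_contra! hge
    obtain ⟨r, -, z, hz, hzr, hp⟩ := hnear _ (hinf.eventually_const_lt
      (show (0 : ℝ) < Metric.infDist (f x) (f '' D) by linarith))
    have := hp z hz hzr
    simp [Metric.infDist_zero_of_mem (mem_image_of_mem f hz)] at this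
  obtain ⟨_, ⟨q, hq, rfl⟩, hxq⟩ := (Metric.infDist_lt_iff (hDne.image f)).1 hzero
  obtain ⟨r, -, z, hz, hzr, hp⟩ := hnear _ ((hx ⟨q, hq⟩).eventually_lt_const
    (show dist (f x) (f q) < ε / 8 from hxq))
  -- This radius keeps `y` within `r` of `x`.
  obtain ⟨y, hy, hyz, hyε⟩ := hosc z hz (r - dist z x) (sub_pos.2 hzr)
  have h₁ : dist (f z) (f q) < ε / 8 := hp z hz hzr
  have h₂ : dist (f y) (f q) < ε / 8 := hp y hy (by linarith [dist_triangle y z x])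
  linarith [dist_triangle_right (f y) (f z) (f q)]

end Metric

theorem mainTheorem6 :
    -- arrows valid for an arbitrary topological space `X`
    (∀ (X : Type*) [TopologicalSpace X] (Y : Type*) [MetricSpace Y] (f : X → Y),
      (Fragmentable f → Cliquish f) ∧
      (Fragmentable f → WeaklySeparated f) ∧
      (IsHereditarilyBaire X → Fragmentable f → PointOfContinuityProperty f) ∧
      (BaireSpace X → GeneralizedLebesgueProperty f → Cliquish f) ∧
      (GeneralizedLebesgueProperty f → WeaklySeparated f) ∧
      (LebesgueProperty f → GeneralizedLebesgueProperty f) ∧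
      (PointOfContinuityProperty f → Fragmentable f) ∧
      (GeneralizedLebesgueProperty f → BorelOne f) ∧
      (TopologicalSpace.SeparableSpace Y → BorelOne f → LebesgueProperty f) ∧
      (BaireSpace X → Cliquish f → PointwiseDiscontinuous f) ∧
      (PointwiseDiscontinuous f → Cliquish f) ∧
      (IsHereditarilyBaire X → GeneralizedLebesgueProperty f → Fragmentable f)) ∧
    -- arrows that need `X` to be a metric space
    (∀ (X : Type*) [MetricSpace X] (Y : Type*) [MetricSpace Y] (f : X → Y),
      (WeaklySeparated f ↔ LTZProperty f) ∧
      (GeneralizedLebesgueProperty f ↔ LTZProperty f) ∧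
      (WeaklySeparated f → GeneralizedLebesgueProperty f) ∧
      (Fragmentable f → BorelOne f) ∧
      (TopologicalSpace.SeparableSpace X → GeneralizedLebesgueProperty f →
        LebesgueProperty f) ∧
      (IsHereditarilyBaire X → BorelOne f → PointOfContinuityProperty f) ∧
      (IsHereditarilyBaire X → WeaklySeparated f → Fragmentable f) ∧
      (IsHereditarilyBaire X → BorelOne f → WeaklySeparated f)) := by
  refine ⟨fun X _ Y _ f => ⟨Fragmentable.cliquish, Fragmentable.weaklySeparated,
    Fragmentable.pointOfContinuityProperty, fun _ => GeneralizedLebesgueProperty.cliquish,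
    GeneralizedLebesgueProperty.weaklySeparated,
    LebesgueProperty.generalizedLebesgueProperty, PointOfContinuityProperty.fragmentable,
    GeneralizedLebesgueProperty.borelOne, fun _ => BorelOne.lebesgueProperty,
    fun _ => Cliquish.pointwiseDiscontinuous, PointwiseDiscontinuous.cliquish,
    GeneralizedLebesgueProperty.fragmentable⟩,
    fun X _ Y _ f => ⟨weaklySeparated_iff_ltzProperty,
    generalizedLebesgueProperty_iff_ltzProperty, WeaklySeparated.generalizedLebesgueProperty,
    fun h => h.weaklySeparated.generalizedLebesgueProperty.borelOne, fun _ h => ?_,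
    fun hX h => (h.fragmentable hX).pointOfContinuityProperty hX,
    fun hX h => h.generalizedLebesgueProperty.fragmentable hX,
    fun hX h => (h.fragmentable hX).weaklySeparated⟩⟩
  have : SecondCountableTopology X := UniformSpace.secondCountable_of_separable X
  exact h.lebesgueProperty
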